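/- Let $\mathbb{F}$ be a field of characteristic $0$. A \emph{graded artinian $\mathbb{F}$-algebra} is a commutative ring $A=\bigoplus_{i\ge 0}A_i$, graded by $\mathbb{N}$, which is a nonzero $\mathbb{F}$-algebra with $A_0=\mathbb{F}$ and $\dim_{\mathbb{F}}A<\infty$ (it need not be generated in degree one). Its \emph{maximal socle degree} is the largest integer $c$ with $A_c\neq 0$. An element $L\in A_1$ is a \emph{strong Lefschetz element in the narrow sense} on $A$ if the multiplication maps $\times L^{c-2i}\colon A_i\to A_{c-i}$ are bijections for all integers $0\le i\le \lfloor c/2\rfloor$, where $c$ is the maximal socle degree of $A$; $A$ has the \emph{strong Lefschetz property in the narrow sense} (SLPn) if such an $L$ exists. Let $A$ and $A'$ be graded artinian $\mathbb{F}$-algebras, and grade $A\otimes_{\mathbb{F}}A'$ by $(A\otimes_{\mathbb{F}}A')_k=\bigoplus_{i+j=k}A_i\otimes_{\mathbb{F}}A'_j$. Then $A\otimes_{\mathbb{F}}A'$ is a graded artinian $\mathbb{F}$-algebra, and: 1. If $\mathbb{F}$ is algebraically closed, $L$ is a strong Lefschetz element in the narrow sense on $A$, and $L'$ is a strong Lefschetz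 element in the narrow sense on $A'$, then $L\otimes 1+1\otimes L'$ is a strong Lefschetz element in the narrow sense on $A\otimes_{\mathbb{F}}A'$. 2. If $A$ and $A'$ satisfy SLPn (with $\mathbb{F}$ not necessarily algebraically closed), then $A\otimes_{\mathbb{F}}A'$ satisfies SLPn. -/

import Mathlib

/-!
Let `c` be the maximal socle degree of `A`. In characteristic zero, `L ∈ A₁` is a strong Lefschetz
element in the narrow sense if and only if multiplication by `L` is the raising operator of an
`𝔰𝔩₂`-action on `A` for which `Aᵢ` has weight `2 * i - c`. One direction is the representation
theory of `𝔰𝔩₂`. For the other, the bijections split `A` into strings generated by primitive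
elements, and the lowering operator is prescribed string by string.

Two such actions, with raising operators `× L` and `× L'`, induce an action on `A ⊗ A'` with raising
operator `× L ⊗ 1 + 1 ⊗ × L' = × (L ⊗ 1 + 1 ⊗ L')`, and `Aᵢ ⊗ A'ⱼ` has weight
`(2 * i - c) + (2 * j - c') = 2 * (i + j) - (c + c')`. As `c + c'` is the maximal socle degree of
`A ⊗ A'`, these are the weights required.
-/

open scoped TensorProduct DirectSum

section GradedArtinian

variable {F A : Type*} [Field F] [CommRing A] [Algebra F A]

/-- A commutative `ℕ`-graded algebra `A = ⨁ 𝒜 i` over a field `F` is a graded artinian `F`-algebra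
if its degree zero component is (the nonzero copy of) the field `F` and it is finite dimensional
over `F`. No hypothesis is made on the degrees of the generators. -/
structure IsGradedArtinianAlgebra (𝒜 : ℕ → Submodule F A) [GradedAlgebra 𝒜] : Prop where
  nontrivial : Nontrivial A
  mem_zero_iff : ∀ a : A, a ∈ 𝒜 0 ↔ ∃ r : F, algebraMap F A r = a
  finite : Module.Finite F A

/-- `c` is the maximal socle degree of `A = ⨁ 𝒜 i`: the largest `c` with `𝒜 c ≠ 0`. -/
def IsMaximalSocleDegree (𝒜 : ℕ → Submodule F A) (c : ℕ) : Prop :=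
  IsGreatest {i : ℕ | 𝒜 i ≠ ⊥} c

/-- `L` is a strong Lefschetz element in the narrow sense on `A = ⨁ 𝒜 i`: it is homogeneous of
degree one and, for `c` the maximal socle degree of `A`, the multiplication maps
`L ^ (c - 2 * i) : 𝒜 i → 𝒜 (c - i)` are bijections for all `0 ≤ i ≤ c / 2`. -/
def IsNarrowStrongLefschetzElement (𝒜 : ℕ → Submodule F A) [GradedAlgebra 𝒜] (L : A) : Prop :=
  L ∈ 𝒜 1 ∧ ∃ c : ℕ, IsMaximalSocleDegree 𝒜 c ∧
    ∀ i : ℕ, 2 * i ≤ c →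
      Set.BijOn (fun x : A => L ^ (c - 2 * i) * x) (𝒜 i : Set A) (𝒜 (c - i) : Set A)

/-- The strong Lefschetz property in the narrow sense (SLPn). -/
def HasNarrowStrongLefschetzProperty (𝒜 : ℕ → Submodule F A) [GradedAlgebra 𝒜] : Prop :=
  ∃ L : A, IsNarrowStrongLefschetzElement 𝒜 L

end GradedArtinian

section TensorGrading

variable {F A B : Type*} [Field F] [CommRing A] [Algebra F A] [CommRing B] [Algebra F B]

/-- The total grading on `A ⊗ B`: its degree `k` component is the sum of the (images of the)
`𝒜 i ⊗ ℬ j` over all `i + j = k`. -/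
def tensorGrading (𝒜 : ℕ → Submodule F A) (ℬ : ℕ → Submodule F B) (k : ℕ) :
    Submodule F (A ⊗[F] B) :=
  ⨆ (p : ℕ × ℕ) (_ : p.1 + p.2 = k),
    LinearMap.range (TensorProduct.mapIncl (𝒜 p.1) (ℬ p.2))

theorem range_mapIncl_le_tensorGrading (𝒜 : ℕ → Submodule F A) (ℬ : ℕ → Submodule F B)
    (p : ℕ × ℕ) :
    LinearMap.range (TensorProduct.mapIncl (𝒜 p.1) (ℬ p.2)) ≤
      tensorGrading 𝒜 ℬ (p.1 + p.2) :=
  le_iSup₂_of_le (f := fun (q : ℕ × ℕ) (_ : q.1 + q.2 = p.1 + p.2) =>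
    LinearMap.range (TensorProduct.mapIncl (𝒜 q.1) (ℬ q.2))) p rfl le_rfl

theorem tmul_mem_tensorGrading (𝒜 : ℕ → Submodule F A) (ℬ : ℕ → Submodule F B)
    {i j : ℕ} {a : A} {b : B} (ha : a ∈ 𝒜 i) (hb : b ∈ ℬ j) :
    a ⊗ₜ[F] b ∈ tensorGrading 𝒜 ℬ (i + j) :=
  range_mapIncl_le_tensorGrading 𝒜 ℬ (i, j) ⟨(⟨a, ha⟩ : 𝒜 i) ⊗ₜ (⟨b, hb⟩ : ℬ j), rfl⟩

/-- A linear property of elements of `tensorGrading 𝒜 ℬ k` can be checked on products of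
homogeneous elements. -/
theorem tensorGrading_induction (𝒜 : ℕ → Submodule F A) (ℬ : ℕ → Submodule F B) {k : ℕ}
    (N : Submodule F (A ⊗[F] B))
    (h : ∀ i j : ℕ, i + j = k → ∀ a ∈ 𝒜 i, ∀ b ∈ ℬ j, a ⊗ₜ[F] b ∈ N) :
    tensorGrading 𝒜 ℬ k ≤ N := by
  refine iSup₂_le fun p hp => ?_
  rintro _ ⟨x, rfl⟩
  induction x with
  | zero => simp
  | add x y hx hy => rw [map_add]; exact N.add_mem hx hy
  | tmul a b => exact h p.1 p.2 hp a a.2 b b.2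

instance tensorGrading_gradedMonoid (𝒜 : ℕ → Submodule F A) (ℬ : ℕ → Submodule F B)
    [GradedAlgebra 𝒜] [GradedAlgebra ℬ] : SetLike.GradedMonoid (tensorGrading 𝒜 ℬ) where
  one_mem := by
    have h := tmul_mem_tensorGrading 𝒜 ℬ (SetLike.one_mem_graded 𝒜) (SetLike.one_mem_graded ℬ)
    rw [Algebra.TensorProduct.one_def]
    exact h
  mul_mem k l x y hx hy := by
    have key : tensorGrading 𝒜 ℬ k ≤
        (tensorGrading 𝒜 ℬ (k + l)).comap (LinearMap.mulRight F y) := by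
      refine tensorGrading_induction 𝒜 ℬ _ fun i j hij a ha b hb => ?_
      have key2 : tensorGrading 𝒜 ℬ l ≤
          (tensorGrading 𝒜 ℬ (k + l)).comap (LinearMap.mulLeft F (a ⊗ₜ[F] b)) := by
        refine tensorGrading_induction 𝒜 ℬ _ fun i' j' hij' a' ha' b' hb' => ?_
        have := tmul_mem_tensorGrading 𝒜 ℬ (SetLike.mul_mem_graded ha ha')
          (SetLike.mul_mem_graded hb hb')
        have e : i + i' + (j + j') = k + l := by omega
        rw [e] at this
        simpa using this
      exact key2 hy
    exact key hx

/-- The map sending `a ⊗ b`, with `a`, `b` homogeneous of degrees `i`, `j`, to `a ⊗ b` placed in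
degree `i + j`. -/
noncomputable def tensorGradingDecompose (𝒜 : ℕ → Submodule F A) (ℬ : ℕ → Submodule F B)
    [GradedAlgebra 𝒜] [GradedAlgebra ℬ] :
    A ⊗[F] B →ₗ[F] ⨁ k, tensorGrading 𝒜 ℬ k :=
  (DirectSum.toModule F (ℕ × ℕ) _ fun p =>
      DirectSum.lof F ℕ (fun k => tensorGrading 𝒜 ℬ k) (p.1 + p.2) ∘ₗ
        (TensorProduct.mapIncl (𝒜 p.1) (ℬ p.2)).codRestrict _ fun x =>
          range_mapIncl_le_tensorGrading 𝒜 ℬ p ⟨x, rfl⟩) ∘ₗ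
    (TensorProduct.directSum F F (fun i => 𝒜 i) (fun j => ℬ j)).toLinearMap ∘ₗ
    TensorProduct.map (DirectSum.decomposeLinearEquiv 𝒜).toLinearMap
      (DirectSum.decomposeLinearEquiv ℬ).toLinearMap

theorem tensorGradingDecompose_tmul (𝒜 : ℕ → Submodule F A) (ℬ : ℕ → Submodule F B)
    [GradedAlgebra 𝒜] [GradedAlgebra ℬ] {i j : ℕ} {a : A} {b : B} (ha : a ∈ 𝒜 i) (hb : b ∈ ℬ j) :
    tensorGradingDecompose 𝒜 ℬ (a ⊗ₜ b) =
      DirectSum.lof F ℕ (fun k => tensorGrading 𝒜 ℬ k) (i + j)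
        ⟨a ⊗ₜ b, tmul_mem_tensorGrading 𝒜 ℬ ha hb⟩ := by
  simp only [tensorGradingDecompose, LinearMap.comp_apply, TensorProduct.map_tmul,
    LinearEquiv.coe_coe, DirectSum.decomposeLinearEquiv_apply, DirectSum.decompose_of_mem 𝒜 ha,
    DirectSum.decompose_of_mem ℬ hb]
  erw [TensorProduct.directSum_lof_tmul_lof, DirectSum.toModule_lof]
  rfl

noncomputable instance tensorGrading_gradedAlgebra (𝒜 : ℕ → Submodule F A)
    (ℬ : ℕ → Submodule F B) [GradedAlgebra 𝒜] [GradedAlgebra ℬ] :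
    GradedAlgebra (tensorGrading 𝒜 ℬ) where
  toGradedMonoid := tensorGrading_gradedMonoid 𝒜 ℬ
  toDecomposition := by
    refine DirectSum.Decomposition.ofLinearMap _ (tensorGradingDecompose 𝒜 ℬ) ?_ ?_
    · refine TensorProduct.ext' fun a b => ?_
      induction a using DirectSum.Decomposition.inductionOn 𝒜 with
      | zero => simp
      | add x y hx hy => rw [TensorProduct.add_tmul, map_add, hx, hy, map_add]
      | homogeneous a =>
        induction b using DirectSum.Decomposition.inductionOn ℬ with
        | zero => simp
        | add x y hx hy => rw [TensorProduct.tmul_add, map_add, hx, hy, map_add]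
        | homogeneous b =>
          rw [LinearMap.comp_apply, tensorGradingDecompose_tmul 𝒜 ℬ a.2 b.2]
          simp
    · refine DirectSum.linearMap_ext F fun k => LinearMap.ext fun x => ?_
      obtain ⟨x, hx⟩ := x
      have key : ∀ y (hy : y ∈ tensorGrading 𝒜 ℬ k), tensorGradingDecompose 𝒜 ℬ y =
          DirectSum.lof F ℕ (fun k => tensorGrading 𝒜 ℬ k) k ⟨y, hy⟩ := by
        have hle : tensorGrading 𝒜 ℬ k ≤
            (LinearMap.eqLocus
              (tensorGradingDecompose 𝒜 ℬ ∘ₗ (tensorGrading 𝒜 ℬ k).subtype)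
              (DirectSum.lof F ℕ (fun k => tensorGrading 𝒜 ℬ k) k)).map (tensorGrading 𝒜 ℬ k).subtype := by
          refine tensorGrading_induction 𝒜 ℬ _ fun i j hij a ha b hb => ?_
          subst hij
          refine ⟨⟨a ⊗ₜ b, tmul_mem_tensorGrading 𝒜 ℬ ha hb⟩, ?_, rfl⟩
          exact tensorGradingDecompose_tmul 𝒜 ℬ ha hb
        intro y hy
        obtain ⟨z, hz, rfl⟩ := hle hy
        exact hz
      simpa using key x hx

end TensorGrading

section Sl2Pair

variable {K V : Type*} [Field K] [AddCommGroup V] [Module K V]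

/-- `e` is a Lefschetz operator on the graded pieces `𝒱 0, …, 𝒱 c`: it raises degrees by one and its
powers identify the pieces placed symmetrically about `c / 2`. This is the strong Lefschetz
condition in the narrow sense, freed from the ring structure. -/
structure IsLefschetzOperator (𝒱 : ℕ → Submodule K V) (c : ℕ) (e : Module.End K V) : Prop where
  eq_bot_of_lt : ∀ i, c < i → 𝒱 i = ⊥
  raise_mem : ∀ i, ∀ v ∈ 𝒱 i, e v ∈ 𝒱 (i + 1)
  bijOn : ∀ i, 2 * i ≤ c → Set.BijOn (e ^ (c - 2 * i)) (𝒱 i) (𝒱 (c - i))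

/-- `e` and `f` are the raising and lowering operators of an `𝔰𝔩₂`-action on the graded pieces
`𝒱 0, …, 𝒱 c`, where `𝒱 i` has weight `2 * i - c`. The relation `[e, f] = h` is imposed on
homogeneous vectors only, and `h` is allowed to vanish, as it does for `c = 0`; Mathlib's
`IsSl2Triple` excludes that case. -/
structure IsSl2Pair (𝒱 : ℕ → Submodule K V) (c : ℕ) (e f : Module.End K V) : Prop where
  eq_bot_of_lt : ∀ i, c < i → 𝒱 i = ⊥
  raise_mem : ∀ i, ∀ v ∈ 𝒱 i, e v ∈ 𝒱 (i + 1)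
  lower_mem : ∀ i, ∀ v ∈ 𝒱 (i + 1), f v ∈ 𝒱 i
  lower_eq_zero : ∀ v ∈ 𝒱 0, f v = 0
  lower_raise : ∀ i, ∀ v ∈ 𝒱 i, f (e v) = e (f v) + ((c : K) - 2 * i) • v

/-- `f` acts on the Lefschetz strings of `e` as the lowering operator of an `𝔰𝔩₂`-action should:
`step` determines it recursively up to the middle degree, and `lower_pow` carries it over to the
degrees above the middle. -/
structure IsLefschetzLowering (𝒱 : ℕ → Submodule K V) (c : ℕ) (e f : Module.End K V) : Prop where
  lower_eq_zero : ∀ v ∈ 𝒱 0, f v = 0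
  step : ∀ i, 2 * (i + 1) ≤ c → ∀ v ∈ 𝒱 (i + 1), ∃ v' ∈ 𝒱 i,
    (e ^ (c - 2 * i)) v' = (e ^ (c - 2 * i - 1)) v ∧ f v = e (f v') + ((c : K) - 2 * i) • v'
  lower_pow : ∀ i, 2 * i ≤ c → ∀ v ∈ 𝒱 i, f ((e ^ (c - 2 * i)) v) =
    (e ^ (c - 2 * i)) (f v) + ((c : K) - 2 * i) • (e ^ (c - 2 * i - 1)) v

theorem pow_apply_mem_of_raise_mem {𝒱 : ℕ → Submodule K V} {e : Module.End K V}
    (he : ∀ i, ∀ v ∈ 𝒱 i, e v ∈ 𝒱 (i + 1)) {i : ℕ} {v : V} (hv : v ∈ 𝒱 i) (n : ℕ) :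
    (e ^ n) v ∈ 𝒱 (i + n) := by
  induction n with
  | zero => exact hv
  | succ n ih =>
    rw [pow_succ', Module.End.mul_apply]
    exact he _ _ ih

theorem exists_linearMap_apply_eq {W : Type*} [AddCommGroup W] [Module K W]
    (𝒱 : ℕ → Submodule K V) [DirectSum.Decomposition 𝒱] (φ : ℕ → V →ₗ[K] W) :
    ∃ f : V →ₗ[K] W, ∀ i, ∀ v ∈ 𝒱 i, f v = φ i v := by
  refine ⟨DirectSum.toModule K ℕ W (fun i => (φ i).domRestrict (𝒱 i)) ∘ₗ
    (DirectSum.decomposeLinearEquiv 𝒱).toLinearMap, fun i v hv => ?_⟩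
  lift v to 𝒱 i using hv
  simp

namespace IsSl2Pair

variable {𝒱 : ℕ → Submodule K V} {c : ℕ} {e f : Module.End K V}

theorem lower_raise_pow_succ (h : IsSl2Pair 𝒱 c e f) {i : ℕ} {v : V} (hv : v ∈ 𝒱 i) (n : ℕ) :
    f ((e ^ (n + 1)) v) =
      (e ^ (n + 1)) (f v) + (((n : K) + 1) * ((c : K) - 2 * i - n)) • (e ^ n) v := by
  induction n with
  | zero => simpa using h.lower_raise i v hv
  | succ n ih =>
    rw [pow_succ' e (n + 1), Module.End.mul_apply,
      h.lower_raise _ _ (pow_apply_mem_of_raise_mem h.raise_mem hv (n + 1)), ih]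
    simp only [pow_succ', Module.End.mul_apply, map_add, map_smul]
    push_cast
    module

theorem raise_lower (h : IsSl2Pair 𝒱 c e f) {i : ℕ} {v : V} (hv : v ∈ 𝒱 i) :
    e (f v) = f (e v) + (2 * (i : K) - c) • v := by
  rw [h.lower_raise i v hv]
  module

theorem lower_pow_apply_mem (h : IsSl2Pair 𝒱 c e f) (n : ℕ) :
    ∀ {i : ℕ} {v : V}, v ∈ 𝒱 (i + n) → (f ^ n) v ∈ 𝒱 i := by
  induction n with
  | zero => exact id
  | succ n ih => exact fun hv => ih (h.lower_mem _ _ hv)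

theorem raise_lower_pow_succ_of_raise_eq_zero (h : IsSl2Pair 𝒱 c e f) (n : ℕ) :
    ∀ {i : ℕ} {v : V}, v ∈ 𝒱 (i + n) → e v = 0 →
      e ((f ^ (n + 1)) v) = (((n : K) + 1) * (2 * (i : K) + n - c)) • (f ^ n) v := by
  induction n with
  | zero =>
    intro i v hv hev
    simpa [hev] using h.raise_lower hv
  | succ n ih =>
    intro i v hv hev
    have hv' : v ∈ 𝒱 (i + 1 + n) := by rwa [add_right_comm, add_assoc]
    rw [pow_succ' f (n + 1), Module.End.mul_apply,
      h.raise_lower (h.lower_pow_apply_mem (n + 1) hv), ih hv' hev, map_smul,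
      ← Module.End.mul_apply, ← pow_succ']
    push_cast
    module

variable [CharZero K]

theorem eq_zero_of_lower_eq_zero (h : IsSl2Pair 𝒱 c e f) {i n : ℕ} {v : V} (hv : v ∈ 𝒱 i)
    (hin : 2 * i + n ≤ c) (hfv : f v = 0) (hev : (e ^ n) v = 0) : v = 0 := by
  induction n with
  | zero => exact hev
  | succ n ih =>
    have hcomm := h.lower_raise_pow_succ hv n
    rw [hev, hfv, map_zero, map_zero, zero_add, eq_comm, smul_eq_zero] at hcomm
    refine ih (by omega) (hcomm.resolve_left (mul_ne_zero n.cast_add_one_ne_zero ?_))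
    rw [sub_sub, sub_ne_zero]
    exact_mod_cast (show c ≠ 2 * i + n by omega)

theorem eq_zero_of_raise_pow_eq_zero (h : IsSl2Pair 𝒱 c e f) {i : ℕ} :
    ∀ {n : ℕ} {v : V}, v ∈ 𝒱 i → 2 * i + n ≤ c → (e ^ n) v = 0 → v = 0 := by
  induction i with
  | zero => exact fun hv hn hev => h.eq_zero_of_lower_eq_zero hv hn (h.lower_eq_zero _ hv) hev
  | succ i ih =>
    intro n v hv hn hev
    refine h.eq_zero_of_lower_eq_zero hv hn (ih (n := n + 1) (h.lower_mem i v hv) (by omega) ?_) hev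
    have hcomm := h.lower_raise_pow_succ hv n
    rwa [pow_succ' e n, Module.End.mul_apply, hev, map_zero, map_zero, smul_zero, add_zero,
      ← Module.End.mul_apply, ← pow_succ', eq_comm] at hcomm

theorem exists_raise_pow_lower_pow_eq_smul (h : IsSl2Pair 𝒱 c e f) (n : ℕ) :
    ∀ {i : ℕ} {v : V}, v ∈ 𝒱 (i + n) → c ≤ 2 * i + n → e v = 0 →
      ∃ a : K, a ≠ 0 ∧ (e ^ n) ((f ^ n) v) = a • v := by
  induction n with
  | zero => exact fun _ _ _ => ⟨1, one_ne_zero, (one_smul K _).symm⟩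
  | succ n ih =>
    intro i v hv hc hev
    have hv' : v ∈ 𝒱 (i + 1 + n) := by rwa [add_right_comm, add_assoc]
    obtain ⟨a, ha, hav⟩ := ih hv' (by omega) hev
    refine ⟨((n : K) + 1) * (2 * ((i + 1 : ℕ) : K) + n - c) * a,
      mul_ne_zero (mul_ne_zero n.cast_add_one_ne_zero ?_) ha, ?_⟩
    · rw [sub_ne_zero]
      exact_mod_cast (show 2 * (i + 1) + n ≠ c by omega)
    · rw [pow_succ e, Module.End.mul_apply, h.raise_lower_pow_succ_of_raise_eq_zero n hv' hev,
        map_smul, hav, smul_smul]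

theorem exists_raise_pow_eq (h : IsSl2Pair 𝒱 c e f) {i n : ℕ} {v : V} (hv : v ∈ 𝒱 (i + n))
    (hc : c ≤ 2 * i + n) : ∃ w ∈ 𝒱 i, (e ^ n) w = v := by
  obtain ⟨k, hk⟩ : ∃ k, c < i + n + k := ⟨c + 1, by omega⟩
  induction k generalizing n v with
  | zero =>
    rw [h.eq_bot_of_lt (i + n) hk, Submodule.mem_bot] at hv
    exact ⟨0, zero_mem _, by rw [hv, map_zero]⟩
  | succ k ih =>
    obtain ⟨w, hw, hwv⟩ := ih (n := n + 1) (h.raise_mem _ v hv) (by omega) (by omega)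
    -- `u` is killed by `e`, so `e ^ n * f ^ n` acts on it by a nonzero scalar.
    set u := v - (e ^ n) w
    have hu : u ∈ 𝒱 (i + n) := sub_mem hv (pow_apply_mem_of_raise_mem h.raise_mem hw n)
    have heu : e u = 0 := by
      rw [map_sub, ← Module.End.mul_apply, ← pow_succ', hwv, sub_self]
    obtain ⟨a, ha, hau⟩ := h.exists_raise_pow_lower_pow_eq_smul n hu hc heu
    refine ⟨w + a⁻¹ • (f ^ n) u,
      add_mem hw (Submodule.smul_mem _ _ (h.lower_pow_apply_mem n hu)), ?_⟩
    rw [map_add, map_smul, hau, inv_smul_smul₀ ha, add_sub_cancel]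

theorem isLefschetzOperator (h : IsSl2Pair 𝒱 c e f) : IsLefschetzOperator 𝒱 c e where
  eq_bot_of_lt := h.eq_bot_of_lt
  raise_mem := h.raise_mem
  bijOn i hi := by
    refine ⟨fun v hv => ?_, fun v hv w hw hvw => ?_, fun v hv => ?_⟩
    · have := pow_apply_mem_of_raise_mem h.raise_mem hv (c - 2 * i)
      rwa [show i + (c - 2 * i) = c - i by omega] at this
    · refine sub_eq_zero.1 (h.eq_zero_of_raise_pow_eq_zero (sub_mem hv hw)
        (show 2 * i + (c - 2 * i) ≤ c by omega) ?_)
      rw [map_sub, sub_eq_zero]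
      exact hvw
    · exact h.exists_raise_pow_eq (by rwa [show i + (c - 2 * i) = c - i by omega]) (by omega)

end IsSl2Pair

namespace IsLefschetzOperator

variable {𝒱 : ℕ → Submodule K V} {c : ℕ} {e : Module.End K V}

theorem exists_leftInverse_pow (h : IsLefschetzOperator 𝒱 c e) {i : ℕ} (hi : 2 * i ≤ c) :
    ∃ s : V →ₗ[K] 𝒱 i, (∀ v ∈ 𝒱 i, (s ((e ^ (c - 2 * i)) v) : V) = v) ∧
      ∀ w ∈ 𝒱 (c - i), (e ^ (c - 2 * i)) (s w) = w := by
  have hinj : Function.Injective ((e ^ (c - 2 * i)).domRestrict (𝒱 i)) :=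
    (h.bijOn i hi).injOn.injective
  obtain ⟨s, hs⟩ := LinearMap.exists_leftInverse_of_injective _ (LinearMap.ker_eq_bot.2 hinj)
  have hs_left (v) (hv : v ∈ 𝒱 i) : (s ((e ^ (c - 2 * i)) v) : V) = v :=
    congrArg Subtype.val (LinearMap.congr_fun hs ⟨v, hv⟩)
  refine ⟨s, hs_left, fun w hw => ?_⟩
  obtain ⟨v, hv, rfl⟩ := (h.bijOn i hi).surjOn hw
  rw [hs_left v hv]

/-- The recursion expresses `f` on `v` through its value on the shift `v'` of `v` one step down the
Lefschetz strings; `v - e v'` is the primitive part of `v`, on which `f` has to vanish. -/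
theorem exists_lowering_lower_half (h : IsLefschetzOperator 𝒱 c e) :
    ∃ f : ℕ → Module.End K V, f 0 = 0 ∧ ∀ i, 2 * (i + 1) ≤ c → ∀ v ∈ 𝒱 (i + 1), ∃ v' ∈ 𝒱 i,
      (e ^ (c - 2 * i)) v' = (e ^ (c - 2 * i - 1)) v ∧
        f (i + 1) v = e (f i v') + ((c : K) - 2 * i) • v' := by
  choose! s hs using fun i (hi : 2 * i ≤ c) => h.exists_leftInverse_pow hi
  let shift (i : ℕ) : Module.End K V := (𝒱 i).subtype ∘ₗ s i ∘ₗ e ^ (c - 2 * i - 1)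
  refine ⟨Nat.rec 0 fun i fi => (e * fi + ((c : K) - 2 * i) • 1) * shift i, rfl,
    fun i hi v hv => ⟨shift i v, (s i _).2, (hs i (by omega)).2 _ ?_, rfl⟩⟩
  have := pow_apply_mem_of_raise_mem h.raise_mem hv (c - 2 * i - 1)
  rwa [show i + 1 + (c - 2 * i - 1) = c - i by omega] at this

end IsLefschetzOperator

namespace IsLefschetzLowering

variable {𝒱 : ℕ → Submodule K V} {c : ℕ} {e f : Module.End K V}

theorem lower_mem_of_two_mul_le (hf : IsLefschetzLowering 𝒱 c e f)
    (he : ∀ i, ∀ v ∈ 𝒱 i, e v ∈ 𝒱 (i + 1)) {i : ℕ} (hi : 2 * (i + 1) ≤ c) {v : V}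
    (hv : v ∈ 𝒱 (i + 1)) : f v ∈ 𝒱 i := by
  induction i generalizing v with
  | zero =>
    obtain ⟨v', hv', -, hfv⟩ := hf.step 0 hi v hv
    rw [hfv, hf.lower_eq_zero v' hv', map_zero, zero_add]
    exact Submodule.smul_mem _ _ hv'
  | succ i ih =>
    obtain ⟨v', hv', -, hfv⟩ := hf.step _ hi v hv
    rw [hfv]
    exact add_mem (he _ _ (ih (by omega) hv')) (Submodule.smul_mem _ _ hv')

theorem pow_lower_mem (hf : IsLefschetzLowering 𝒱 c e f)
    (he : ∀ i, ∀ v ∈ 𝒱 i, e v ∈ 𝒱 (i + 1)) {i j n : ℕ} (hi : 2 * i ≤ c) (hj : i + n = j + 1)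
    {v : V} (hv : v ∈ 𝒱 i) : (e ^ n) (f v) ∈ 𝒱 j := by
  cases i with
  | zero =>
    rw [hf.lower_eq_zero v hv, map_zero]
    exact zero_mem _
  | succ i =>
    have := pow_apply_mem_of_raise_mem he (hf.lower_mem_of_two_mul_le he hi hv) n
    rwa [show i + n = j by omega] at this

theorem lower_mem (hf : IsLefschetzLowering 𝒱 c e f) (h : IsLefschetzOperator 𝒱 c e) {i : ℕ}
    {v : V} (hv : v ∈ 𝒱 (i + 1)) : f v ∈ 𝒱 i := by
  by_cases hi : 2 * (i + 1) ≤ c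
  · exact hf.lower_mem_of_two_mul_le h.raise_mem hi hv
  by_cases hic : c < i + 1
  · rw [h.eq_bot_of_lt _ hic, Submodule.mem_bot] at hv
    rw [hv, map_zero]
    exact zero_mem _
  obtain ⟨k, rfl⟩ : ∃ k, c = k + (i + 1) := ⟨c - (i + 1), by omega⟩
  obtain ⟨w, hw, rfl⟩ := (h.bijOn k (by omega)).surjOn
    (show v ∈ 𝒱 (k + (i + 1) - k) by rwa [Nat.add_sub_cancel_left])
  rw [hf.lower_pow k (by omega) w hw]
  have hw' := pow_apply_mem_of_raise_mem h.raise_mem hw (k + (i + 1) - 2 * k - 1)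
  rw [show k + (k + (i + 1) - 2 * k - 1) = i by omega] at hw'
  exact add_mem (hf.pow_lower_mem h.raise_mem (by omega) (by omega) hw)
    (Submodule.smul_mem _ _ hw')

theorem lower_raise_below_middle (hf : IsLefschetzLowering 𝒱 c e f)
    (h : IsLefschetzOperator 𝒱 c e) {i : ℕ} (hi : 2 * i < c) {v : V} (hv : v ∈ 𝒱 i) :
    f (e v) = e (f v) + ((c : K) - 2 * i) • v := by
  obtain hmid | hlt := (Nat.succ_le_of_lt hi).eq_or_lt
  · have hpow : c - 2 * i = 1 := by omega
    simpa [hpow] using hf.lower_pow i hi.le v hv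
  · obtain ⟨v', hv', hev', hfv⟩ := hf.step i (by omega) (e v) (h.raise_mem i v hv)
    rw [← Module.End.mul_apply, ← pow_succ, Nat.sub_add_cancel (by omega)] at hev'
    rwa [(h.bijOn i hi.le).injOn hv' hv hev'] at hfv

theorem lower_raise_above_middle (hf : IsLefschetzLowering 𝒱 c e f)
    (h : IsLefschetzOperator 𝒱 c e) {i : ℕ} (hi : 2 * i ≤ c) {v : V} (hv : v ∈ 𝒱 i) :
    f (e ((e ^ (c - 2 * i)) v)) =
      e (f ((e ^ (c - 2 * i)) v)) + (2 * (i : K) - c) • (e ^ (c - 2 * i)) v := by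
  obtain ⟨n, rfl⟩ := Nat.exists_eq_add_of_le hi
  have hpow := hf.lower_pow i hi v hv
  simp only [Nat.add_sub_cancel_left, Nat.cast_add, Nat.cast_mul, Nat.cast_ofNat,
    add_sub_cancel_left, sub_add_cancel_left] at hpow ⊢
  have hshift : (n : K) • e ((e ^ (n - 1)) v) = (n : K) • (e ^ n) v := by
    cases n with
    | zero => simp
    | succ n => rw [Nat.add_sub_cancel, ← Module.End.mul_apply, ← pow_succ']
  have hright : e (f ((e ^ n) v)) = (e ^ (n + 1)) (f v) + (n : K) • (e ^ n) v := by
    rw [hpow, map_add, map_smul, hshift, pow_succ', Module.End.mul_apply]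
  suffices hcomm : f ((e ^ (n + 1)) v) = (e ^ (n + 1)) (f v) by
    rw [hright, neg_smul, add_neg_cancel_right, ← hcomm, pow_succ', Module.End.mul_apply]
  cases i with
  | zero =>
    have htop := pow_apply_mem_of_raise_mem h.raise_mem hv (n + 1)
    rw [h.eq_bot_of_lt _ (by omega), Submodule.mem_bot] at htop
    rw [htop, hf.lower_eq_zero v hv, map_zero, map_zero]
  | succ i =>
    obtain ⟨v', hv', hev', hfv⟩ := hf.step i hi v hv
    have hpow' := hf.lower_pow i (by omega) v' hv'
    rw [show 2 * (i + 1) + n - 2 * i = n + 2 by omega, Nat.add_succ_sub_one] at hev' hpow'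
    rw [← hev', hpow', hfv, map_add, map_smul, pow_succ e (n + 1), Module.End.mul_apply]

theorem isSl2Pair (hf : IsLefschetzLowering 𝒱 c e f) (h : IsLefschetzOperator 𝒱 c e) :
    IsSl2Pair 𝒱 c e f where
  eq_bot_of_lt := h.eq_bot_of_lt
  raise_mem := h.raise_mem
  lower_mem _ _ := hf.lower_mem h
  lower_eq_zero := hf.lower_eq_zero
  lower_raise i v hv := by
    obtain hi | hi := lt_or_ge (2 * i) c
    · exact hf.lower_raise_below_middle h hi hv
    obtain hic | hic := lt_or_ge c i
    · rw [h.eq_bot_of_lt i hic, Submodule.mem_bot] at hv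
      simp [hv]
    obtain ⟨k, rfl⟩ := Nat.exists_eq_add_of_le' hic
    obtain ⟨w, hw, rfl⟩ := (h.bijOn k (by omega)).surjOn
      (show v ∈ 𝒱 (k + i - k) by rwa [Nat.add_sub_cancel_left])
    rw [hf.lower_raise_above_middle h (by omega) hw]
    push_cast
    module

end IsLefschetzLowering

namespace IsLefschetzOperator

variable {𝒱 : ℕ → Submodule K V} {c : ℕ} {e : Module.End K V} [DirectSum.Decomposition 𝒱]

theorem exists_isLefschetzLowering (h : IsLefschetzOperator 𝒱 c e) :
    ∃ f, IsLefschetzLowering 𝒱 c e f := by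
  obtain ⟨g, hg_zero, hg_succ⟩ := h.exists_lowering_lower_half
  choose! s hs using fun i (hi : 2 * i ≤ c) => h.exists_leftInverse_pow hi
  let upper (i : ℕ) : Module.End K V :=
    (e ^ (c - 2 * i) * g i + ((c : K) - 2 * i) • e ^ (c - 2 * i - 1)) * (𝒱 i).subtype ∘ₗ s i
  obtain ⟨f, hf⟩ := exists_linearMap_apply_eq 𝒱 fun j => if 2 * j ≤ c then g j else upper (c - j)
  have hf_lower {j : ℕ} (hj : 2 * j ≤ c) {v : V} (hv : v ∈ 𝒱 j) : f v = g j v := by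
    rw [hf j v hv, if_pos hj]
  refine ⟨f, fun v hv => ?_, fun i hi v hv => ?_, fun i hi v hv => ?_⟩
  · rw [hf_lower (by omega) hv, hg_zero, LinearMap.zero_apply]
  · obtain ⟨v', hv', hev', hgv⟩ := hg_succ i hi v hv
    exact ⟨v', hv', hev', by rw [hf_lower hi hv, hf_lower (by omega) hv', hgv]⟩
  · obtain rfl | hlt := hi.eq_or_lt
    · simp
    · rw [hf (c - i) _ ((h.bijOn i hi).mapsTo hv), if_neg (by omega),
        show c - (c - i) = i by omega, hf_lower hi hv]
      have hs_left := (hs i hi).1 v hv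
      simp [upper, hs_left]

theorem exists_isSl2Pair (h : IsLefschetzOperator 𝒱 c e) : ∃ f, IsSl2Pair 𝒱 c e f :=
  have ⟨f, hf⟩ := h.exists_isLefschetzLowering
  ⟨f, hf.isSl2Pair h⟩

end IsLefschetzOperator

theorem isLefschetzOperator_iff_exists_isSl2Pair [CharZero K] {𝒱 : ℕ → Submodule K V}
    [DirectSum.Decomposition 𝒱] {c : ℕ} {e : Module.End K V} :
    IsLefschetzOperator 𝒱 c e ↔ ∃ f, IsSl2Pair 𝒱 c e f :=
  ⟨fun h => h.exists_isSl2Pair, fun ⟨_, h⟩ => h.isLefschetzOperator⟩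

end Sl2Pair

section Tensor

variable {F A B : Type*} [Field F] [CommRing A] [Algebra F A] [CommRing B] [Algebra F B]
  {𝒜 : ℕ → Submodule F A} {ℬ : ℕ → Submodule F B} {c d : ℕ}

theorem tmul_mem_tensorGrading_of_add_eq {i j k : ℕ} (hk : i + j = k) {a : A} {b : B}
    (ha : a ∈ 𝒜 i) (hb : b ∈ ℬ j) : a ⊗ₜ[F] b ∈ tensorGrading 𝒜 ℬ k :=
  hk ▸ tmul_mem_tensorGrading 𝒜 ℬ ha hb

theorem tensorGrading_eq_bot_of_lt (hA : ∀ i, c < i → 𝒜 i = ⊥) (hB : ∀ j, d < j → ℬ j = ⊥)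
    {k : ℕ} (hk : c + d < k) : tensorGrading 𝒜 ℬ k = ⊥ := by
  refine eq_bot_iff.2 (tensorGrading_induction 𝒜 ℬ _ fun i j hij a ha b hb => ?_)
  rw [Submodule.mem_bot]
  obtain hi | hj : c < i ∨ d < j := by omega
  · rw [hA i hi, Submodule.mem_bot] at ha
    rw [ha, TensorProduct.zero_tmul]
  · rw [hB j hj, Submodule.mem_bot] at hb
    rw [hb, TensorProduct.tmul_zero]

theorem IsSl2Pair.tensor {e f : Module.End F A} {e' f' : Module.End F B}
    (h : IsSl2Pair 𝒜 c e f) (h' : IsSl2Pair ℬ d e' f') :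
    IsSl2Pair (tensorGrading 𝒜 ℬ) (c + d) (e.rTensor B + e'.lTensor A)
      (f.rTensor B + f'.lTensor A) where
  eq_bot_of_lt _ := tensorGrading_eq_bot_of_lt h.eq_bot_of_lt h'.eq_bot_of_lt
  raise_mem k := by
    refine tensorGrading_induction 𝒜 ℬ
      (.comap (e.rTensor B + e'.lTensor A) (tensorGrading 𝒜 ℬ (k + 1)))
      fun i j hij a ha b hb => ?_
    exact add_mem
      (tmul_mem_tensorGrading_of_add_eq (by omega) (h.raise_mem i a ha) hb)
      (tmul_mem_tensorGrading_of_add_eq (by omega) ha (h'.raise_mem j b hb))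
  lower_mem k := by
    refine tensorGrading_induction 𝒜 ℬ
      (.comap (f.rTensor B + f'.lTensor A) (tensorGrading 𝒜 ℬ k))
      fun i j hij a ha b hb => ?_
    have hleft : f a ⊗ₜ[F] b ∈ tensorGrading 𝒜 ℬ k := by
      cases i with
      | zero => simp [h.lower_eq_zero a ha]
      | succ i => exact tmul_mem_tensorGrading_of_add_eq (by omega) (h.lower_mem i a ha) hb
    have hright : a ⊗ₜ[F] f' b ∈ tensorGrading 𝒜 ℬ k := by
      cases j with
      | zero => simp [h'.lower_eq_zero b hb]
      | succ j => exact tmul_mem_tensorGrading_of_add_eq (by omega) ha (h'.lower_mem j b hb)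
    exact add_mem hleft hright
  lower_eq_zero := by
    refine tensorGrading_induction 𝒜 ℬ (LinearMap.ker _) fun i j hij a ha b hb => ?_
    obtain ⟨rfl, rfl⟩ := Nat.add_eq_zero_iff.1 hij
    simp [h.lower_eq_zero a ha, h'.lower_eq_zero b hb]
  lower_raise k := by
    refine tensorGrading_induction 𝒜 ℬ (LinearMap.eqLocus
      ((f.rTensor B + f'.lTensor A) * (e.rTensor B + e'.lTensor A))
      ((e.rTensor B + e'.lTensor A) * (f.rTensor B + f'.lTensor A) +
        (((c + d : ℕ) : F) - 2 * k) • 1)) fun i j hij a ha b hb => ?_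
    subst hij
    simp only [LinearMap.mem_eqLocus, Module.End.mul_apply, LinearMap.add_apply,
      LinearMap.smul_apply, Module.End.one_apply, map_add, LinearMap.rTensor_tmul,
      LinearMap.lTensor_tmul, h.lower_raise i a ha, h'.lower_raise j b hb,
      TensorProduct.add_tmul, TensorProduct.tmul_add, ← TensorProduct.smul_tmul',
      TensorProduct.tmul_smul]
    push_cast
    module

theorem IsMaximalSocleDegree.eq_bot_of_lt (hc : IsMaximalSocleDegree 𝒜 c) (i : ℕ) (hi : c < i) :
    𝒜 i = ⊥ :=
  of_not_not fun h => hi.not_ge (hc.2 h)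

theorem IsMaximalSocleDegree.tensor (hc : IsMaximalSocleDegree 𝒜 c)
    (hd : IsMaximalSocleDegree ℬ d) : IsMaximalSocleDegree (tensorGrading 𝒜 ℬ) (c + d) := by
  refine ⟨fun htop => ?_, fun k hk => le_of_not_gt fun hlt =>
    hk (tensorGrading_eq_bot_of_lt hc.eq_bot_of_lt hd.eq_bot_of_lt hlt)⟩
  have := Submodule.nontrivial_iff_ne_bot.2 hc.1
  have := Submodule.nontrivial_iff_ne_bot.2 hd.1
  have hinj : Function.Injective (TensorProduct.mapIncl (𝒜 c) (ℬ d)) :=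
    TensorProduct.map_injective_of_flat_flat _ _ (𝒜 c).injective_subtype (ℬ d).injective_subtype
  obtain ⟨t, ht⟩ := exists_ne (0 : 𝒜 c ⊗[F] ℬ d)
  have hmem := range_mapIncl_le_tensorGrading 𝒜 ℬ (c, d) ⟨t, rfl⟩
  rw [htop, Submodule.mem_bot] at hmem
  exact ht (hinj (hmem.trans (map_zero _).symm))

variable [GradedAlgebra 𝒜] [GradedAlgebra ℬ]

theorem IsGradedArtinianAlgebra.tensor (hA : IsGradedArtinianAlgebra 𝒜)
    (hB : IsGradedArtinianAlgebra ℬ) : IsGradedArtinianAlgebra (tensorGrading 𝒜 ℬ) where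
  nontrivial :=
    have := hA.nontrivial
    have := hB.nontrivial
    inferInstance
  finite :=
    have := hA.finite
    have := hB.finite
    inferInstance
  mem_zero_iff z := by
    refine ⟨fun hz => ?_, fun ⟨r, hr⟩ => hr ▸ SetLike.algebraMap_mem_graded _ r⟩
    refine tensorGrading_induction 𝒜 ℬ (LinearMap.range (Algebra.linearMap F (A ⊗[F] B)))
      (fun i j hij a ha b hb => ?_) hz
    obtain ⟨rfl, rfl⟩ := Nat.add_eq_zero_iff.1 hij
    obtain ⟨r, rfl⟩ := (hA.mem_zero_iff a).1 ha
    obtain ⟨s, rfl⟩ := (hB.mem_zero_iff b).1 hb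
    refine ⟨r * s, ?_⟩
    rw [Algebra.linearMap_apply, map_mul, Algebra.TensorProduct.algebraMap_apply r,
      Algebra.TensorProduct.algebraMap_apply s, Algebra.TensorProduct.tmul_one_eq_one_tmul s,
      Algebra.TensorProduct.tmul_mul_tmul, mul_one, one_mul]

theorem isNarrowStrongLefschetzElement_iff {L : A} :
    IsNarrowStrongLefschetzElement 𝒜 L ↔
      L ∈ 𝒜 1 ∧ ∃ c, IsMaximalSocleDegree 𝒜 c ∧
        IsLefschetzOperator 𝒜 c (LinearMap.mulLeft F L) := by
  refine and_congr_right fun hL => exists_congr fun c => and_congr_right fun hc => ?_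
  have hpow (n : ℕ) : ⇑(LinearMap.mulLeft F L ^ n) = fun x => L ^ n * x := by
    ext x
    rw [LinearMap.pow_mulLeft, LinearMap.mulLeft_apply]
  refine ⟨fun h => ⟨hc.eq_bot_of_lt, fun i a ha => ?_, fun i hi => ?_⟩, fun h i hi => ?_⟩
  · rw [add_comm]
    exact SetLike.mul_mem_graded hL ha
  · rw [hpow]
    exact h i hi
  · rw [← hpow]
    exact h.bijOn i hi

theorem tmul_one_add_one_tmul_mem_tensorGrading {L : A} {L' : B} {k : ℕ} (hL : L ∈ 𝒜 k)
    (hL' : L' ∈ ℬ k) : L ⊗ₜ[F] (1 : B) + (1 : A) ⊗ₜ[F] L' ∈ tensorGrading 𝒜 ℬ k :=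
  add_mem (tmul_mem_tensorGrading_of_add_eq (add_zero k) hL (SetLike.one_mem_graded ℬ))
    (tmul_mem_tensorGrading_of_add_eq (zero_add k) (SetLike.one_mem_graded 𝒜) hL')

theorem mulLeft_tmul_one_add_one_tmul (L : A) (L' : B) :
    LinearMap.mulLeft F (L ⊗ₜ[F] (1 : B) + (1 : A) ⊗ₜ[F] L') =
      (LinearMap.mulLeft F L).rTensor B + (LinearMap.mulLeft F L').lTensor A := by
  ext a b
  simp [add_mul]

theorem IsNarrowStrongLefschetzElement.tensor [CharZero F] {L : A} {L' : B}
    (h : IsNarrowStrongLefschetzElement 𝒜 L) (h' : IsNarrowStrongLefschetzElement ℬ L') :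
    IsNarrowStrongLefschetzElement (tensorGrading 𝒜 ℬ)
      (L ⊗ₜ[F] (1 : B) + (1 : A) ⊗ₜ[F] L') := by
  obtain ⟨hL, c, hc, hLef⟩ := isNarrowStrongLefschetzElement_iff.1 h
  obtain ⟨hL', d, hd, hLef'⟩ := isNarrowStrongLefschetzElement_iff.1 h'
  obtain ⟨f, hf⟩ := isLefschetzOperator_iff_exists_isSl2Pair.1 hLef
  obtain ⟨f', hf'⟩ := isLefschetzOperator_iff_exists_isSl2Pair.1 hLef'
  refine isNarrowStrongLefschetzElement_iff.2
    ⟨tmul_one_add_one_tmul_mem_tensorGrading hL hL', c + d, hc.tensor hd, ?_⟩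
  rw [mulLeft_tmul_one_add_one_tmul]
  exact (hf.tensor hf').isLefschetzOperator

end Tensor

theorem mainTheorem2_general {F A A' : Type*} [Field F] [CharZero F]
    [CommRing A] [Algebra F A] [CommRing A'] [Algebra F A']
    (𝒜 : ℕ → Submodule F A) [GradedAlgebra 𝒜]
    (𝒜' : ℕ → Submodule F A') [GradedAlgebra 𝒜'] :
    (IsGradedArtinianAlgebra 𝒜 → IsGradedArtinianAlgebra 𝒜' →
      IsGradedArtinianAlgebra (tensorGrading 𝒜 𝒜')) ∧
    (∀ (L : A) (L' : A'),
      IsNarrowStrongLefschetzElement 𝒜 L → IsNarrowStrongLefschetzElement 𝒜' L' →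
        IsNarrowStrongLefschetzElement (tensorGrading 𝒜 𝒜')
          (L ⊗ₜ[F] (1 : A') + (1 : A) ⊗ₜ[F] L')) ∧
    (HasNarrowStrongLefschetzProperty 𝒜 → HasNarrowStrongLefschetzProperty 𝒜' →
      HasNarrowStrongLefschetzProperty (tensorGrading 𝒜 𝒜')) :=
  ⟨fun hA hA' => hA.tensor hA', fun _ _ h h' => h.tensor h',
    fun ⟨_, h⟩ ⟨_, h'⟩ => ⟨_, h.tensor h'⟩⟩

theorem mainTheorem2 {F A A' : Type*} [Field F] [CharZero F]
    [CommRing A] [Algebra F A] [CommRing A'] [Algebra F A']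
    (𝒜 : ℕ → Submodule F A) [GradedAlgebra 𝒜]
    (𝒜' : ℕ → Submodule F A') [GradedAlgebra 𝒜']
    (hA : IsGradedArtinianAlgebra 𝒜) (hA' : IsGradedArtinianAlgebra 𝒜') :
    IsGradedArtinianAlgebra (tensorGrading 𝒜 𝒜') ∧
    (IsAlgClosed F → ∀ (L : A) (L' : A'),
      IsNarrowStrongLefschetzElement 𝒜 L → IsNarrowStrongLefschetzElement 𝒜' L' →
        IsNarrowStrongLefschetzElement (tensorGrading 𝒜 𝒜')
          (L ⊗ₜ[F] (1 : A') + (1 : A) ⊗ₜ[F] L')) ∧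
    (HasNarrowStrongLefschetzProperty 𝒜 → HasNarrowStrongLefschetzProperty 𝒜' →
      HasNarrowStrongLefschetzProperty (tensorGrading 𝒜 𝒜')) := by
  obtain ⟨hartinian, helement, hproperty⟩ := mainTheorem2_general 𝒜 𝒜'
  exact ⟨hartinian hA hA', fun _ => helement, hproperty⟩
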